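/- **Theorem.** For $n\ge 1$ let $F_n$ be the fan graph, with vertices $0,1,\dots,n$ and edges $(0,i)$ for $1\le i\le n$ and $(i,i+1)$ for $1\le i\le n-1$. Let $P_{F_n}(t)$ be the Kazhdan--Lusztig polynomial of the graphic (cycle) matroid of $F_n$. Then $$P_{F_n}(t)=\sum_{k=0}^{\lfloor (n-1)/2\rfloor}\frac{1}{k+1}\binom{n-1}{k,\;k,\;n-2k-1}\,t^k .$$ Here the Kazhdan--Lusztig polynomials $P_M(t)\in\mathbb Z[t]$ of (finite, loopless) matroids $M$ are the unique family of polynomials such that: $P_M(t)=1$ if $\operatorname{rk} M=0$; $\deg P_M(t)<(\operatorname{rk} M)/2$ if $\operatorname{rk} M>0$; and for every $M$ the polynomial $Z_M(t)=\sum_F t^{\operatorname{rk} F}P_{M/F}(t)$, where $F$ runs over all flats of $M$ and $M/F$ denotes the contraction, satisfies $Z_M(t)=t^{\operatorname{rk} M}Z_M(t^{-1})$. -/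

import Mathlib

open Polynomial

/-! ### Graphic matroids and fan graphs -/

namespace SimpleGraph

/-- A set of edges of `G` is independent in the cycle matroid of `G` if it contains no cycle. -/
def IsForestSet {V : Type*} (G : SimpleGraph V) (I : Set (Sym2 V)) : Prop :=
  I ⊆ G.edgeSet ∧ (fromEdgeSet I).IsAcyclic

/-- The augmentation property: if `I` is a forest of `G` that is not maximal and `B` is a maximal
forest of `G`, then some edge of `B` can be added to `I`. -/
theorem IsForestSet.exists_insert {V : Type*} {G : SimpleGraph V} {I B : Set (Sym2 V)}
    (hI : G.IsForestSet I) (hI' : ¬ Maximal G.IsForestSet I) (hB : Maximal G.IsForestSet B) :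
    ∃ x ∈ B \ I, G.IsForestSet (insert x I) := by
  have key : ∀ {J : Set (Sym2 V)}, G.IsForestSet J →
      (Maximal G.IsForestSet J ↔
        Maximal (fun H : SimpleGraph V => H ≤ G ∧ H.IsAcyclic) (fromEdgeSet J)) := by
    intro J hJ
    have hes : ∀ {K : Set (Sym2 V)}, K ⊆ G.edgeSet → (fromEdgeSet K).edgeSet = K := by
      intro K hK
      rw [edgeSet_fromEdgeSet]
      ext e
      exact ⟨fun h => h.1, fun h => ⟨h, G.not_isDiag_of_mem_edgeSet (hK h)⟩⟩
    have hle : ∀ {K : Set (Sym2 V)}, K ⊆ G.edgeSet → fromEdgeSet K ≤ G := by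
      intro K hK
      rw [← edgeSet_subset_edgeSet, hes hK]
      exact hK
    constructor
    · intro h
      refine ⟨⟨hle hJ.1, hJ.2⟩, ?_⟩
      rintro H ⟨hHG, hH⟩ hJH
      have h1 : G.IsForestSet H.edgeSet :=
        ⟨edgeSet_subset_edgeSet.2 hHG, by rwa [fromEdgeSet_edgeSet]⟩
      have h2 : J ⊆ H.edgeSet := by
        have := edgeSet_subset_edgeSet.2 hJH
        rwa [hes hJ.1] at this
      have h3 := h.2 h1 h2
      rw [← edgeSet_subset_edgeSet, hes hJ.1]
      exact h3
    · intro h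
      refine ⟨hJ, ?_⟩
      intro K hK hJK
      have h1 := h.2 ⟨hle hK.1, hK.2⟩ (fromEdgeSet_mono hJK)
      rw [← edgeSet_subset_edgeSet, hes hJ.1, hes hK.1] at h1
      exact h1
  have hle : ∀ {K : Set (Sym2 V)}, K ⊆ G.edgeSet → fromEdgeSet K ≤ G := by
    intro K hK a b hab
    exact hK ((fromEdgeSet_adj K).1 hab).1
  have hBr := (maximal_isAcyclic_iff_reachable_eq (hle hB.1.1) hB.1.2).1 ((key hB.1).1 hB)
  by_contra hcon
  refine hI' ((key hI).2 ((maximal_isAcyclic_iff_reachable_eq (hle hI.1) hI.2).2 ?_))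
  have hadj : ∀ a b, (fromEdgeSet B).Adj a b → (fromEdgeSet I).Reachable a b := by
    intro a b hab
    obtain ⟨habB, hne⟩ := (fromEdgeSet_adj B).1 hab
    by_contra hnr
    have habI : s(a, b) ∉ I := fun h => hnr ((fromEdgeSet_adj I).2 ⟨h, hne⟩).reachable
    refine hcon ⟨s(a, b), ⟨habB, habI⟩, Set.insert_subset (hB.1.1 habB) hI.1, ?_⟩
    have := hI.2.sup_edge_of_not_reachable hnr
    rw [edge, ← fromEdgeSet_union, Set.union_singleton] at this
    exact this
  ext u v
  constructor
  · exact fun h => h.mono (hle hI.1)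
  · intro h
    rw [← hBr] at h
    obtain ⟨p⟩ := h
    induction p with
    | nil => exact Reachable.refl _
    | cons h _ ih => exact (hadj _ _ h).trans ih

/-- The cycle matroid (graphic matroid) of a finite simple graph: the ground set is the edge set,
and the independent sets are the sets of edges that contain no cycle. -/
def cycleMatroid {V : Type*} [Finite V] (G : SimpleGraph V) : Matroid (Sym2 V) :=
  (IndepMatroid.ofBdd G.edgeSet G.IsForestSet
    ⟨Set.empty_subset _, by simp⟩
    (fun _ _ hJ hIJ => ⟨hIJ.trans hJ.1, hJ.2.anti (fromEdgeSet_mono hIJ)⟩)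
    (fun _ _ hI hI' hB => hI.exists_insert hI' hB)
    (fun _ hI => hI.1)
    ⟨G.edgeSet.ncard, fun I hI => by
      rw [(Set.toFinite G.edgeSet).cast_ncard_eq]
      exact Set.encard_le_encard hI.1⟩).matroid

theorem cycleMatroid_ground {V : Type*} [Finite V] (G : SimpleGraph V) :
    G.cycleMatroid.E = G.edgeSet := rfl

theorem cycleMatroid_indep {V : Type*} [Finite V] (G : SimpleGraph V) (I : Set (Sym2 V)) :
    G.cycleMatroid.Indep I ↔ I ⊆ G.edgeSet ∧ (fromEdgeSet I).IsAcyclic := Iff.rfl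

instance cycleMatroid_finite {V : Type*} [Finite V] (G : SimpleGraph V) :
    G.cycleMatroid.Finite :=
  ⟨Set.toFinite _⟩

/-- The fan graph `F_n`: the vertices are `0, 1, …, n`, and the edges are `(0, i)` for
`1 ≤ i ≤ n` and `(i, i + 1)` for `1 ≤ i ≤ n - 1`. -/
def fan (n : ℕ) : SimpleGraph (Fin (n + 1)) :=
  SimpleGraph.fromRel fun i j =>
    (i.val = 0 ∧ 1 ≤ j.val) ∨ (1 ≤ i.val ∧ j.val = i.val + 1)

end SimpleGraph

/-! ### Kazhdan–Lusztig polynomials of matroids -/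

namespace Matroid

/-- The rank of a finite matroid, as a natural number. -/
noncomputable def rankNat {α : Type*} (M : Matroid α) : ℕ := M.eRank.toNat

/-- The rank of a set in a finite matroid, as a natural number. -/
noncomputable def rkNat {α : Type*} (M : Matroid α) (F : Set α) : ℕ := (M.eRk F).toNat

/-- The finite set `L(M)` of all flats of a finite matroid. -/
noncomputable def flatsFinset {α : Type*} (M : Matroid α) [M.Finite] : Finset (Set α) :=
  (M.ground_finite.finite_subsets.subset
    (fun _ hF => hF.subset_ground : {F | M.IsFlat F} ⊆ {F | F ⊆ M.E})).toFinset

theorem mem_flatsFinset {α : Type*} {M : Matroid α} [M.Finite] {F : Set α} :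
    F ∈ M.flatsFinset ↔ M.IsFlat F := by
  simp [flatsFinset]

/-- For `f` of degree at most `d`, the polynomial `g` with `2 * deg g < d` for which `f + g` is
palindromic of degree `d`: for `2 * k < d` its coefficient at `t ^ k` is the difference of the
coefficients of `f` at `t ^ (d - k)` and `t ^ k`. -/
noncomputable def palCompletion (d : ℕ) (f : ℤ[X]) : ℤ[X] :=
  ∑ k ∈ (Finset.range d).filter (fun k => 2 * k < d), C (f.coeff (d - k) - f.coeff k) * X ^ k

/-- Contracting a flat that is not the smallest one makes the ground set smaller. -/
theorem contract_ground_ncard_lt {α : Type*} {M : Matroid α} [M.Finite] {F : Set α}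
    (hF : M.IsFlat F) (hne : F ≠ M.loops) : (M ／ F).E.ncard < M.E.ncard := by
  refine Set.ncard_lt_ncard ?_ M.ground_finite
  obtain ⟨e, he⟩ : F.Nonempty := by
    rw [Set.nonempty_iff_ne_empty]
    rintro rfl
    exact hne (Set.subset_empty_iff.1 hF.loops_subset).symm
  exact ⟨M.contract_ground_subset_ground F, fun h => (h (hF.subset_ground he)).2 he⟩

/-- The Kazhdan–Lusztig polynomial `P_M(t)` of a finite matroid `M`. It is `1` in rank `0`; in
positive rank it is the polynomial of degree less than `(rk M) / 2` for which
`∑_F t ^ (rk F) * P_{M / F}(t)` (sum over all flats) is palindromic of degree `rk M`. The recursion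
runs over the flats other than the smallest flat, which is the set of loops. -/
noncomputable def klPoly {α : Type*} (M : Matroid α) [M.Finite] : ℤ[X] :=
  if M.rankNat = 0 then 1
  else palCompletion M.rankNat
    (∑ F : {F : Set α // F ∈ M.flatsFinset.erase M.loops}, X ^ M.rkNat F.1 * klPoly (M ／ F.1))
termination_by M.E.ncard
decreasing_by
  exact contract_ground_ncard_lt (mem_flatsFinset.1 (Finset.mem_of_mem_erase F.2))
    (Finset.ne_of_mem_erase F.2)

/-- `f ∈ ℤ[t]` is palindromic of degree `d`, that is, `f(t) = t ^ d * f(1 / t)`. -/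
def IsPal (d : ℕ) (f : ℤ[X]) : Prop :=
  f.natDegree ≤ d ∧ ∀ k ≤ d, f.coeff k = f.coeff (d - k)

theorem coeff_palCompletion (d : ℕ) (f : ℤ[X]) (k : ℕ) :
    (palCompletion d f).coeff k = if 2 * k < d then f.coeff (d - k) - f.coeff k else 0 := by
  simp only [palCompletion, finsetSum_coeff, coeff_C_mul_X_pow]
  rw [Finset.sum_ite_eq]
  congr 1
  simp only [Finset.mem_filter, Finset.mem_range, eq_iff_iff]
  omega

theorem rankNat_contract_add {α : Type*} (M : Matroid α) [M.Finite] {F : Set α}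
    (hF : F ⊆ M.E) : (M ／ F).rankNat + M.rkNat F = M.rankNat := by
  obtain ⟨I, hI⟩ := M.exists_isBasis F
  obtain ⟨B, hB, hIB⟩ := hI.indep.exists_isBase_superset
  have hBF : B ∩ F = I :=
    (hI.eq_of_subset_indep (hB.indep.inter_right F) (Set.subset_inter hIB hI.subset)
      Set.inter_subset_right).symm
  have h1 := hB.isBasis_ground.contract_isBasis hI
    (hB.indep.subset (Set.union_subset Set.sdiff_subset hIB))
  have h2 : (M ／ F).IsBase (B \ F) := by
    rw [← isBasis_ground_iff]
    exact h1
  have hfin : B.Finite := M.ground_finite.subset hB.subset_ground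
  have h3 : (B \ F).encard + I.encard = B.encard := by
    rw [← hBF]
    exact Set.encard_sdiff_add_encard_inter B F
  rw [rankNat, rkNat, rankNat, ← h2.encard_eq_eRank, ← hB.encard_eq_eRank, ← hI.encard_eq_eRk,
    ← h3, ENat.toNat_add]
  · exact (hfin.subset Set.sdiff_subset).encard_lt_top.ne
  · exact (hfin.subset hIB).encard_lt_top.ne

theorem klPoly_eq {α : Type*} (M : Matroid α) [M.Finite] :
    klPoly M = if M.rankNat = 0 then 1 else palCompletion M.rankNat
      (∑ F ∈ M.flatsFinset.erase M.loops, X ^ M.rkNat F * klPoly (M ／ F)) := by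
  rw [klPoly, Finset.sum_coe_sort (M.flatsFinset.erase M.loops)
    (fun F => X ^ M.rkNat F * klPoly (M ／ F))]

theorem sum_flats_eq {α : Type*} (M : Matroid α) [M.Finite] [M.Loopless]
    (P : ∀ N : Matroid α, N.Finite → ℤ[X]) :
    ∑ F ∈ M.flatsFinset, X ^ M.rkNat F * P (M ／ F) inferInstance =
      P M inferInstance +
        ∑ F ∈ M.flatsFinset.erase M.loops, X ^ M.rkNat F * P (M ／ F) inferInstance := by
  have hL : M.loops ∈ M.flatsFinset := mem_flatsFinset.2 (M.isFlat_closure ∅)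
  rw [← Finset.add_sum_erase _ _ hL]
  congr 1
  have h0 : M.loops = ∅ := M.loops_eq_empty
  have h1 : M ／ M.loops = M := by rw [h0, contract_empty]
  have h2 : M.rkNat M.loops = 0 := by simp [rkNat]
  rw [h2, pow_zero, one_mul]
  congr 1

/-- The properties that characterize the Kazhdan–Lusztig polynomials of loopless matroids. -/
structure IsKLFamily {α : Type*} (P : ∀ M : Matroid α, M.Finite → ℤ[X]) : Prop where
  rank_zero : ∀ (M : Matroid α) (hM : M.Finite), M.Loopless → M.rankNat = 0 → P M hM = 1
  degree_lt : ∀ (M : Matroid α) (hM : M.Finite), M.Loopless → 0 < M.rankNat →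
    2 * (P M hM).natDegree < M.rankNat
  isPal : ∀ (M : Matroid α) [M.Finite], M.Loopless →
    IsPal M.rankNat (∑ F ∈ M.flatsFinset, X ^ M.rkNat F * P (M ／ F) inferInstance)

theorem klPoly_degree_lt {α : Type*} (M : Matroid α) [M.Finite] (h : 0 < M.rankNat) :
    2 * (klPoly M).natDegree < M.rankNat := by
  by_contra hcon
  have hc : ∀ k, ¬ 2 * k < M.rankNat → (klPoly M).coeff k = 0 := fun k hk => by
    rw [klPoly_eq M, if_neg h.ne', coeff_palCompletion, if_neg hk]
  have h0 : klPoly M = 0 := leadingCoeff_eq_zero.1 (hc _ hcon)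
  rw [h0] at hcon
  simp at hcon
  omega

theorem klPoly_natDegree_le {α : Type*} (M : Matroid α) [M.Finite] :
    (klPoly M).natDegree ≤ M.rankNat := by
  rcases Nat.eq_zero_or_pos M.rankNat with h | h
  · rw [klPoly_eq, if_pos h]
    simp
  · have := klPoly_degree_lt M h
    omega

/-- The polynomials `klPoly M` have the characterizing properties. -/
theorem isKLFamily_klPoly {α : Type*} :
    IsKLFamily (fun (M : Matroid α) (_ : M.Finite) => klPoly M) where
  rank_zero M hM _ h := by rw [klPoly_eq, if_pos h]
  degree_lt M hM _ h := klPoly_degree_lt M h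
  isPal M hM hl := by
    have hdeg : (∑ F ∈ M.flatsFinset, X ^ M.rkNat F * klPoly (M ／ F)).natDegree ≤ M.rankNat := by
      refine natDegree_sum_le_of_forall_le _ _ fun F hF => ?_
      refine natDegree_mul_le.trans ?_
      rw [natDegree_X_pow, ← rankNat_contract_add M (mem_flatsFinset.1 hF).subset_ground]
      have := klPoly_natDegree_le (M ／ F)
      omega
    refine ⟨hdeg, fun k hk => ?_⟩
    rw [sum_flats_eq M (fun N _ => klPoly N), coeff_add, coeff_add, klPoly_eq M]
    rcases Nat.eq_zero_or_pos M.rankNat with h | h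
    · obtain rfl : k = 0 := by omega
      simp [h]
    · rw [if_neg h.ne', coeff_palCompletion, coeff_palCompletion]
      split_ifs with h1 h2 h2
      · omega
      · omega
      · rw [Nat.sub_sub_self hk]
        omega
      · have : k = M.rankNat - k := by omega
        rw [← this]

/-- The polynomials `klPoly M` are the only ones with the characterizing properties. -/
theorem IsKLFamily.eq_klPoly {α : Type*} {P : ∀ M : Matroid α, M.Finite → ℤ[X]}
    (hP : IsKLFamily P) (M : Matroid α) (hM : M.Finite) (hl : M.Loopless) :
    P M hM = klPoly M := by
  induction hn : M.E.ncard using Nat.strong_induction_on generalizing M with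
  | _ n ih =>
    subst hn
    have hsum : ∑ F ∈ M.flatsFinset.erase M.loops, X ^ M.rkNat F * P (M ／ F) inferInstance =
        ∑ F ∈ M.flatsFinset.erase M.loops, X ^ M.rkNat F * klPoly (M ／ F) := by
      refine Finset.sum_congr rfl fun F hF => ?_
      have hF' := mem_flatsFinset.1 (Finset.mem_of_mem_erase hF)
      rw [ih _ (contract_ground_ncard_lt hF' (Finset.ne_of_mem_erase hF)) (M ／ F) inferInstance
        (by rw [loopless_iff, contract_loops_eq, hF'.closure, Set.sdiff_self]) rfl]
    rcases Nat.eq_zero_or_pos M.rankNat with h | h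
    · rw [hP.rank_zero M hM hl h, klPoly_eq, if_pos h]
    · have hp := hP.isPal M hl
      have hd := hP.degree_lt M hM hl h
      have hz : ∀ j, M.rankNat ≤ 2 * j → (P M hM).coeff j = 0 := fun j hj =>
        coeff_eq_zero_of_natDegree_lt (by omega)
      rw [sum_flats_eq M P, hsum] at hp
      rw [klPoly_eq, if_neg h.ne']
      ext k
      rw [coeff_palCompletion]
      split_ifs with hk
      · have := hp.2 k (by omega)
        rw [coeff_add, coeff_add, hz (M.rankNat - k) (by omega)] at this
        linarith
      · exact hz k (by omega)

end Matroid

/-! A flat of the fan is a partition of the vertices into connected blocks. A block that avoids the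
hub `0` is an interval of the path, so a flat is a word in the letters `zero`, `start`, `cont`.
Contracting it leaves, up to parallel edges, fans glued at the hub, one for each run of blocks
uninterrupted by a vertex in the block of `0`. The Kazhdan–Lusztig polynomial of the contraction
should therefore be the product `wordKL` of fan polynomials over the runs. No separate
multiplicativity theorem is needed: by `klPoly_contract_eq_of_isPal`, a guess on all flats is
correct as soon as it satisfies the degree bounds and its weighted sums over upper intervals are
palindromic.

The guess `fanPoly` has generating function `1 + u M`, with `M` the Motzkin series; its coefficients
`catalan k * choose n (2 * k)` give the degree bound and the stated formula. For palindromicity,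
`sum_coarsenings` factors the sum above a flat into one `wordPoly 0` per run. Let `Z` be the
generating function of these factors and `R` the part from words without `zero`, so that `Z = R (1 +
t u Z)`. The Motzkin equation at `u / (1 - t u)` is an equation for `R`; eliminating `R` gives the
Narayana equation `Z = 1 + (1 + t) u Z + t u² Z²`, whose recursion visibly preserves palindromicity.
-/

namespace Matroid

/-! ### Palindromic polynomials -/

theorem isPal_iff_reflect {d : ℕ} {f : ℤ[X]} :
    IsPal d f ↔ f.natDegree ≤ d ∧ reflect d f = f := by
  refine and_congr_right fun hd => ⟨fun h => ?_, fun h k hk => ?_⟩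
  · ext k
    rw [coeff_reflect]
    rcases le_or_gt k d with hk | hk
    · rw [revAt_le hk, h k hk]
    · rw [revAt_eq_self_of_lt hk]
  · conv_lhs => rw [← h]
    rw [coeff_reflect, revAt_le hk]

theorem IsPal.mul {d e : ℕ} {f g : ℤ[X]} (hf : IsPal d f) (hg : IsPal e g) :
    IsPal (d + e) (f * g) := by
  rw [isPal_iff_reflect] at *
  exact ⟨natDegree_mul_le.trans (add_le_add hf.1 hg.1), by rw [reflect_mul _ _ hf.1 hg.1, hf.2, hg.2]⟩

theorem IsPal.add {d : ℕ} {f g : ℤ[X]} (hf : IsPal d f) (hg : IsPal d g) : IsPal d (f + g) :=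
  ⟨natDegree_add_le_of_degree_le hf.1 hg.1, fun k hk => by
    rw [coeff_add, coeff_add, hf.2 k hk, hg.2 k hk]⟩

theorem IsPal.sum {ι : Type*} {s : Finset ι} {d : ℕ} {f : ι → ℤ[X]}
    (h : ∀ i ∈ s, IsPal d (f i)) : IsPal d (∑ i ∈ s, f i) :=
  ⟨natDegree_sum_le_of_forall_le _ _ fun i hi => (h i hi).1, fun k hk => by
    rw [finsetSum_coeff, finsetSum_coeff]
    exact Finset.sum_congr rfl fun i hi => (h i hi).2 k hk⟩

theorem isPal_one : IsPal 0 1 := ⟨by simp, fun k hk => by simp [Nat.le_zero.1 hk]⟩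

theorem isPal_X : IsPal 2 X := by
  refine ⟨natDegree_X_le.trans one_le_two, fun k hk => ?_⟩
  interval_cases k <;> simp [coeff_X]

theorem isPal_one_add_X : IsPal 1 (1 + X) := by
  refine ⟨natDegree_add_le_of_degree_le (by simp) natDegree_X_le, fun k hk => ?_⟩
  interval_cases k <;> simp [coeff_X, coeff_one]

/-- Two polynomials of degree less than `d / 2` that are completed to palindromic polynomials by
the same polynomial are equal. -/
theorem IsPal.eq_of_add {d : ℕ} {f g r : ℤ[X]} (hf : IsPal d (f + r)) (hg : IsPal d (g + r))
    (hfd : 2 * f.natDegree < d) (hgd : 2 * g.natDegree < d) : f = g := by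
  ext k
  rcases lt_or_ge (2 * k) d with hk | hk
  · have h1 := hf.2 k (by omega)
    have h2 := hg.2 k (by omega)
    simp only [coeff_add] at h1 h2
    rw [coeff_eq_zero_of_natDegree_lt (by omega : f.natDegree < d - k)] at h1
    rw [coeff_eq_zero_of_natDegree_lt (by omega : g.natDegree < d - k)] at h2
    linarith
  · rw [coeff_eq_zero_of_natDegree_lt (by omega), coeff_eq_zero_of_natDegree_lt (by omega)]

/-! ### Flats of contractions and recognition of Kazhdan–Lusztig polynomials -/

section Contract

variable {α : Type*} {M : Matroid α} {F G : Set α}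

theorem IsFlat.contract_loopless (hF : M.IsFlat F) : (M ／ F).Loopless := by
  rw [loopless_iff, contract_loops_eq, hF.closure, Set.sdiff_self]

theorem IsFlat.union_of_contract (hF : M.IsFlat F) (hG : (M ／ F).IsFlat G) :
    M.IsFlat (G ∪ F) := by
  have h := hG.closure
  rw [contract_closure_eq] at h
  have h1 : F ⊆ M.closure (G ∪ F) :=
    M.subset_closure_of_subset' Set.subset_union_right hF.subset_ground
  have h2 := Set.sdiff_union_of_subset h1
  rw [h] at h2
  exact isFlat_iff_closure_eq.2 h2.symm

theorem IsFlat.contract_sdiff (hG : M.IsFlat G) (hFG : F ⊆ G) : (M ／ F).IsFlat (G \ F) := by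
  rw [isFlat_iff_closure_eq, contract_closure_eq, Set.sdiff_union_of_subset hFG, hG.closure]

open Classical in
theorem sum_flatsFinset_contract [M.Finite] (hF : M.IsFlat F) (f : Set α → ℤ[X]) :
    ∑ G ∈ (M ／ F).flatsFinset, f (G ∪ F) =
      ∑ G ∈ M.flatsFinset with F ⊆ G, f G := by
  refine Finset.sum_bij' (fun G _ => G ∪ F) (fun G _ => G \ F) ?_ ?_ ?_ ?_ ?_
  · intro G hG
    rw [Finset.mem_filter, mem_flatsFinset]
    exact ⟨hF.union_of_contract (mem_flatsFinset.1 hG), Set.subset_union_right⟩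
  · intro G hG
    rw [Finset.mem_filter, mem_flatsFinset] at hG
    exact mem_flatsFinset.2 (hG.1.contract_sdiff hG.2)
  · intro G hG
    rw [Set.union_sdiff_right, sdiff_eq_left]
    exact (Set.subset_sdiff.1 (mem_flatsFinset.1 hG).subset_ground).2
  · intro G hG
    exact Set.sdiff_union_of_subset (Finset.mem_filter.1 hG).2
  · intro G hG
    rfl

theorem rkNat_union_of_contract [M.Finite] (hF : F ⊆ M.E) (hG : G ⊆ (M ／ F).E) :
    M.rkNat (G ∪ F) = (M ／ F).rkNat G + M.rkNat F := by
  have h1 := rankNat_contract_add M hF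
  have h2 := rankNat_contract_add (M ／ F) hG
  have h3 := rankNat_contract_add M (F := G ∪ F)
    (Set.union_subset (hG.trans (M.contract_ground_subset_ground F)) hF)
  rw [contract_contract, Set.union_comm] at h2
  omega

open Classical in
/-- A function on the flats of `M` that satisfies the degree bounds of the Kazhdan–Lusztig
polynomials of the contractions of `M`, and whose weighted sums over upper intervals of the lattice
of flats are palindromic, computes these polynomials. -/
theorem klPoly_contract_eq_of_isPal [M.Finite] (p : Set α → ℤ[X])
    (hp0 : ∀ F, M.IsFlat F → (M ／ F).rankNat = 0 → p F = 1)
    (hpd : ∀ F, M.IsFlat F → 0 < (M ／ F).rankNat → 2 * (p F).natDegree < (M ／ F).rankNat)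
    (hpal : ∀ F, M.IsFlat F → ∃ Q, IsPal (M ／ F).rankNat Q ∧
      ∑ G ∈ M.flatsFinset with F ⊆ G, X ^ M.rkNat G * p G = X ^ M.rkNat F * Q)
    (hF : M.IsFlat F) : klPoly (M ／ F) = p F := by
  induction hn : (M ／ F).E.ncard using Nat.strong_induction_on generalizing F with
  | _ n ih =>
    subst hn
    rcases Nat.eq_zero_or_pos (M ／ F).rankNat with h | h
    · rw [hp0 F hF h, klPoly_eq, if_pos h]
    have hl := hF.contract_loopless
    have hL : (M ／ F).loops = ∅ := (M ／ F).loops_eq_empty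
    have hk := isKLFamily_klPoly.isPal (M ／ F) hl
    rw [sum_flats_eq (M ／ F) (fun N _ => klPoly N)] at hk
    obtain ⟨Q, hQ, hQs⟩ := hpal F hF
    -- Dividing the sum over flats above `F` by `X ^ rk F` gives a sum over the flats of `M ／ F`.
    -- Its smallest flat contributes `p F`; the other terms are known by induction.
    have hsum : p F + ∑ G ∈ (M ／ F).flatsFinset.erase (M ／ F).loops,
        X ^ (M ／ F).rkNat G * klPoly ((M ／ F) ／ G) = Q := by
      have hmem : (M ／ F).loops ∈ (M ／ F).flatsFinset :=
        mem_flatsFinset.2 ((M ／ F).isFlat_closure ∅)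
      have key : ∑ G ∈ (M ／ F).flatsFinset, X ^ (M ／ F).rkNat G * p (G ∪ F) = Q := by
        refine mul_left_cancel₀ (pow_ne_zero (M.rkNat F) (X_ne_zero (R := ℤ))) ?_
        rw [← hQs, ← sum_flatsFinset_contract hF (fun G => X ^ M.rkNat G * p G), Finset.mul_sum]
        refine Finset.sum_congr rfl fun G hG => ?_
        rw [rkNat_union_of_contract hF.subset_ground (mem_flatsFinset.1 hG).subset_ground]
        ring
      rw [← key, ← Finset.add_sum_erase _ _ hmem, hL, Set.empty_union]
      congr 1
      · simp [rkNat]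
      · refine Finset.sum_congr rfl fun G hG => ?_
        have hG' := mem_flatsFinset.1 (Finset.mem_of_mem_erase hG)
        have hlt := contract_ground_ncard_lt hG' (hL ▸ Finset.ne_of_mem_erase hG)
        have hU := hF.union_of_contract hG'
        have hc : (M ／ F) ／ G = M ／ (G ∪ F) := by rw [contract_contract, Set.union_comm]
        have : klPoly ((M ／ F) ／ G) = klPoly (M ／ (G ∪ F)) := by congr 1
        rw [this, ih _ (by rwa [hc] at hlt) hU rfl]
    exact IsPal.eq_of_add hk (hsum ▸ hQ) (klPoly_degree_lt _ h) (hpd F hF h)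

end Contract

end Matroid

/-! ### The Motzkin series -/

namespace PowerSeries

/-- Substitution of a power series without constant term, as an algebra homomorphism. -/
noncomputable def substHom {R : Type*} [CommRing R] {a : R⟦X⟧} (ha : constantCoeff a = 0) :
    R⟦X⟧ →ₐ[R] R⟦X⟧ :=
  substAlgHom (HasSubst.of_constantCoeff_zero' ha)

section SubstHom

variable {R : Type*} [CommRing R] {a : R⟦X⟧} (ha : constantCoeff a = 0)

theorem substHom_X : substHom ha X = a := substAlgHom_X _

theorem substHom_C (r : R) : substHom ha (C r) = C r := (substHom ha).commutes r

/-- This reduces each coefficient of a substituted series to a finite sum, since `a ^ N` is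
divisible by `X ^ N`. -/
theorem substHom_eq_sum (N : ℕ) (f : R⟦X⟧) :
    ∃ g, substHom ha f = ∑ k ∈ Finset.range N, C (coeff k f) * a ^ k + a ^ N * g := by
  have h := congrArg (substHom ha) (eq_X_pow_mul_shift_add_trunc N f)
  refine ⟨substHom ha (mk fun i => coeff (i + N) f), h.trans ?_⟩
  have h2 : (trunc N f : R⟦X⟧) = ∑ k ∈ Finset.range N, C (coeff k f) * X ^ k := by
    ext n
    simp only [Polynomial.coeff_coe, coeff_trunc, map_sum, coeff_C_mul, coeff_X_pow]
    simp
  rw [h2]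
  simp only [map_add, map_mul, map_pow, map_sum, substHom_X, substHom_C]
  ring

end SubstHom

/-- The generating function of the Motzkin polynomials, which count Motzkin paths by their length
and their number of up steps. -/
noncomputable def motzkinSeries : ℤ[X]⟦X⟧ :=
  mk 1 * substHom (a := C (Polynomial.X : ℤ[X]) * X ^ 2 * mk 1 ^ 2) (by simp)
    (catalanSeries.map (Nat.castRingHom ℤ[X]))

/-- With `a = t u² / (1 - u)²`, the Catalan series at `a` satisfies `c = 1 + a c²`. Substituting `c
= (1 - u) M` gives `(1 - u) M = 1 + t u² M²`. -/
theorem motzkinSeries_eq :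
    motzkinSeries = 1 + X * motzkinSeries + C (Polynomial.X : ℤ[X]) * (X * motzkinSeries) ^ 2 := by
  have h1 := congrArg (map (Nat.castRingHom ℤ[X])) catalanSeries_sq_mul_X_add_one
  have h2 := congrArg
    (substHom (R := ℤ[X]) (a := C (Polynomial.X : ℤ[X]) * X ^ 2 * mk 1 ^ 2) (by simp)) h1
  have hg := mk_one_mul_one_sub_eq_one ℤ[X]
  simp only [map_add, map_mul, map_pow, map_one, map_X, substHom_X] at h2
  rw [motzkinSeries]
  generalize substHom (R := ℤ[X]) _ (catalanSeries.map (Nat.castRingHom ℤ[X])) = c at h2 ⊢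
  linear_combination c * hg - h2

theorem coeff_X_pow_mul_mk_one_pow {R : Type*} [CommRing R] (d n : ℕ) :
    coeff n (X ^ d * mk 1 ^ (d + 1) : R⟦X⟧) = (n.choose d : R) := by
  rw [mk_one_pow_eq_mk_choose_add, coeff_X_pow_mul']
  split_ifs with h
  · simp [Nat.add_sub_cancel' h]
  · rw [Nat.choose_eq_zero_of_lt (by omega), Nat.cast_zero]

theorem coeff_motzkinSeries (n : ℕ) :
    coeff n motzkinSeries = ∑ k ∈ Finset.range (n + 1),
      Polynomial.C ((catalan k : ℤ) * n.choose (2 * k)) * Polynomial.X ^ k := by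
  rw [motzkinSeries]
  obtain ⟨g, hg⟩ := substHom_eq_sum (a := C (Polynomial.X : ℤ[X]) * X ^ 2 * mk 1 ^ 2) (by simp)
    (n + 1) (catalanSeries.map (Nat.castRingHom ℤ[X]))
  rw [hg, mul_add, map_add]
  have h0 : (mk 1 : ℤ[X]⟦X⟧) * ((C (Polynomial.X : ℤ[X]) * X ^ 2 * mk 1 ^ 2) ^ (n + 1) * g) =
      X ^ (2 * (n + 1)) * (C (Polynomial.X : ℤ[X]) ^ (n + 1) * mk 1 ^ (2 * n + 3) * g) := by ring
  rw [h0, coeff_X_pow_mul', if_neg (by omega), add_zero, Finset.mul_sum, map_sum]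
  refine Finset.sum_congr rfl fun k _ => ?_
  have h1 : (mk 1 : ℤ[X]⟦X⟧) * (C (coeff k (catalanSeries.map (Nat.castRingHom ℤ[X]))) *
      (C (Polynomial.X : ℤ[X]) * X ^ 2 * mk 1 ^ 2) ^ k) =
      C ((catalan k : ℤ[X]) * Polynomial.X ^ k) * (X ^ (2 * k) * mk 1 ^ (2 * k + 1)) := by
    rw [coeff_map, catalanSeries_coeff, map_mul, map_pow]
    simp only [eq_natCast, map_natCast]
    ring
  rw [h1, coeff_C_mul, coeff_X_pow_mul_mk_one_pow]
  simp only [map_mul, map_natCast]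
  ring

end PowerSeries

/-! ### Generating functions and the Narayana equation -/

namespace FanGraph

open PowerSeries (motzkinSeries substHom substHom_X substHom_C motzkinSeries_eq
  coeff_motzkinSeries)
open scoped PowerSeries

/-- The polynomials that turn out to be the Kazhdan–Lusztig polynomials of the fan graphs, with the
value `1` for the fan with no edges. -/
noncomputable def fanPoly (n : ℕ) : ℤ[X] := PowerSeries.coeff n (1 + PowerSeries.X * motzkinSeries)

theorem fanPoly_zero : fanPoly 0 = 1 := by simp [fanPoly]

theorem fanPoly_succ (n : ℕ) : fanPoly (n + 1) = PowerSeries.coeff n motzkinSeries := by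
  simp [fanPoly, PowerSeries.coeff_one, PowerSeries.coeff_succ_X_mul]

theorem two_mul_natDegree_fanPoly_lt (n : ℕ) : 2 * (fanPoly (n + 1)).natDegree < n + 1 := by
  rw [fanPoly_succ, coeff_motzkinSeries]
  suffices h : ((∑ k ∈ Finset.range (n + 1),
      C ((catalan k : ℤ) * n.choose (2 * k)) * X ^ k : ℤ[X])).natDegree ≤ n / 2 by omega
  refine natDegree_sum_le_of_forall_le _ _ fun k _ => ?_
  rcases le_or_gt (2 * k) n with hk | hk
  · exact (natDegree_C_mul_X_pow_le _ _).trans (by omega)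
  · simp [Nat.choose_eq_zero_of_lt hk]

/-- The generating function of `fanPoly (k + i)` at `u / (1 - t u)`. -/
noncomputable def runSeries (k : ℕ) : ℤ[X]⟦X⟧ :=
  -- The factor `u / (1 - t u)` stands for one block: a `start` followed by any number of `cont`s,
  -- each of weight `t`.
  substHom (a := PowerSeries.X * PowerSeries.invOfUnit (1 - PowerSeries.C X * PowerSeries.X) 1)
    (by simp) (PowerSeries.mk fun i => fanPoly (k + i))

theorem one_sub_mul_inv :
    (1 - PowerSeries.C X * PowerSeries.X) *
      PowerSeries.invOfUnit (1 - PowerSeries.C (X : ℤ[X]) * PowerSeries.X) 1 = 1 :=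
  PowerSeries.mul_invOfUnit _ 1 (by simp)

theorem one_sub_mul_runSeries (k : ℕ) :
    (1 - PowerSeries.C X * PowerSeries.X) * runSeries k =
      (1 - PowerSeries.C X * PowerSeries.X) * PowerSeries.C (fanPoly k) +
        PowerSeries.X * runSeries (k + 1) := by
  have h : (PowerSeries.mk fun i => fanPoly (k + i)) = PowerSeries.C (fanPoly k) +
      PowerSeries.X * PowerSeries.mk fun i => fanPoly (k + 1 + i) := by
    ext1 (_ | n)
    · simp
    · simp [PowerSeries.coeff_succ_X_mul, add_assoc, add_comm 1 n]
  rw [runSeries, runSeries, h, map_add, map_mul, substHom_X, substHom_C]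
  linear_combination
    PowerSeries.X * substHom _ (PowerSeries.mk fun i => fanPoly (k + 1 + i)) * one_sub_mul_inv

/-- Put `a = u / (1 - t u)` and `m = M(a)`. Then `R - 1 = a m`, and the Motzkin equation reads `m =
R + t (R - 1)²`; multiply `R - 1 = a m` by `1 - t u`. -/
theorem runSeries_zero_eq :
    (runSeries 0 - 1) * (1 - PowerSeries.C X * PowerSeries.X) =
      PowerSeries.X * (runSeries 0 + PowerSeries.C X * (runSeries 0 - 1) ^ 2) := by
  have h0 : (PowerSeries.mk fun i => fanPoly (0 + i)) = 1 + PowerSeries.X * motzkinSeries := by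
    ext1 n
    simp [fanPoly]
  have h := congrArg (substHom (R := ℤ[X])
    (a := PowerSeries.X * PowerSeries.invOfUnit (1 - PowerSeries.C X * PowerSeries.X) 1) (by simp))
    motzkinSeries_eq
  simp only [map_add, map_mul, map_pow, map_one, substHom_X, substHom_C] at h
  rw [runSeries, h0]
  simp only [map_add, map_mul, map_one, substHom_X]
  have hw := one_sub_mul_inv
  generalize substHom _ motzkinSeries = m at h ⊢
  generalize PowerSeries.invOfUnit (1 - PowerSeries.C X * PowerSeries.X : ℤ[X]⟦X⟧) 1 = w at *
  linear_combination PowerSeries.X * h + (PowerSeries.X * m) * hw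

/-- The generating function of the sums over all flats: up to a shift, the
generating function of the Narayana polynomials. -/
noncomputable def flatSeries : ℤ[X]⟦X⟧ :=
  runSeries 0 *
    PowerSeries.invOfUnit (1 - PowerSeries.C X * PowerSeries.X * runSeries 0) 1

/-- A word is a part without `zero`, possibly followed by a `zero` of weight `t` and another word.
-/
theorem flatSeries_eq_mul :
    flatSeries = (1 + PowerSeries.C X * PowerSeries.X * flatSeries) * runSeries 0 := by
  have h := PowerSeries.mul_invOfUnit (1 - PowerSeries.C X * PowerSeries.X * runSeries 0) 1
    (by simp)
  rw [flatSeries]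
  linear_combination runSeries 0 * h

theorem flatSeries_eq :
    flatSeries = 1 + PowerSeries.C (1 + X) * PowerSeries.X * flatSeries +
      PowerSeries.C X * PowerSeries.X ^ 2 * flatSeries ^ 2 := by
  have h := flatSeries_eq_mul
  have h2 := runSeries_zero_eq
  rw [map_add, map_one]
  generalize flatSeries = Z at *
  generalize runSeries 0 = R at *
  generalize PowerSeries.C (X : ℤ[X]) = t at *
  generalize (PowerSeries.X : ℤ[X]⟦X⟧) = u at *
  linear_combination (1 + t * u * Z) ^ 2 * h2 + ((1 - t * u) * (1 + t * u * Z) -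
    u * (1 + t * u * Z) - u * t * (Z + (1 + t * u * Z) * R - 2 * (1 + t * u * Z))) * h

/-- The generating function of the sums over the words that continue a run with `k` blocks. -/
noncomputable def wordSeries : ℕ → ℤ[X]⟦X⟧
  | 0 => flatSeries
  | k + 1 => (1 + PowerSeries.C X * PowerSeries.X * flatSeries) *
      -- The extra factor `1 / (1 - t u)` counts the leading `cont`s, which extend the block already
      -- open.
      PowerSeries.invOfUnit (1 - PowerSeries.C X * PowerSeries.X) 1 * runSeries (k + 1)

theorem wordSeries_zero :
    wordSeries 0 = 1 + PowerSeries.X * (PowerSeries.C X * wordSeries 0 + wordSeries 1) := by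
  have h := flatSeries_eq_mul
  have h2 := one_sub_mul_runSeries 0
  rw [fanPoly_zero, map_one, zero_add] at h2
  have hw := one_sub_mul_inv
  rw [wordSeries, wordSeries, zero_add]
  generalize PowerSeries.invOfUnit (1 - PowerSeries.C X * PowerSeries.X : ℤ[X]⟦X⟧) 1 = w at *
  linear_combination h + (1 + PowerSeries.C X * PowerSeries.X * flatSeries) * w * h2 +
    (1 + PowerSeries.C X * PowerSeries.X * flatSeries) * (1 - runSeries 0) * hw

/-- This is the recursion on the first letter: `zero` closes the run and contributes `fanPoly (k +
1)`, `start` adds a block, `cont` leaves the number of blocks unchanged. -/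
theorem wordSeries_succ (k : ℕ) :
    wordSeries (k + 1) = PowerSeries.C (fanPoly (k + 1)) +
      PowerSeries.X * (PowerSeries.C (X * fanPoly (k + 1)) * wordSeries 0 + wordSeries (k + 2) +
        PowerSeries.C X * wordSeries (k + 1)) := by
  have h2 := one_sub_mul_runSeries (k + 1)
  have hw := one_sub_mul_inv
  rw [wordSeries, wordSeries, wordSeries, map_mul]
  generalize PowerSeries.invOfUnit (1 - PowerSeries.C X * PowerSeries.X : ℤ[X]⟦X⟧) 1 = w at *
  linear_combination (1 + PowerSeries.C X * PowerSeries.X * flatSeries) * w * h2 +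
    (1 + PowerSeries.C X * PowerSeries.X * flatSeries) * PowerSeries.C (fanPoly (k + 1)) * hw

/-- The weighted sum over all words of length `m` that continue a run with `k` blocks. -/
noncomputable def wordPoly (k m : ℕ) : ℤ[X] := PowerSeries.coeff m (wordSeries k)

theorem wordPoly_zero_right (k : ℕ) : wordPoly k 0 = fanPoly k := by
  rcases k with _ | k
  · rw [wordPoly, wordSeries_zero]
    simp [fanPoly_zero]
  · rw [wordPoly, wordSeries_succ]
    simp

theorem wordPoly_zero_succ (m : ℕ) :
    wordPoly 0 (m + 1) = X * wordPoly 0 m + wordPoly 1 m := by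
  rw [wordPoly, wordSeries_zero]
  simp [PowerSeries.coeff_one, PowerSeries.coeff_succ_X_mul, wordPoly]

theorem wordPoly_succ_succ (k m : ℕ) :
    wordPoly (k + 1) (m + 1) = X * fanPoly (k + 1) * wordPoly 0 m + wordPoly (k + 2) m +
      X * wordPoly (k + 1) m := by
  rw [wordPoly, wordSeries_succ]
  simp [PowerSeries.coeff_succ_X_mul, wordPoly, mul_assoc]

/-- The Narayana equation gives `Z_(m+2) = (1 + t) Z_(m+1) + t ∑ Z_i Z_j` over `i + j = m`. Here `1
+ t` is palindromic of degree 1 and `t` of degree 2, so every term is palindromic of degree `m + 2`.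
-/
theorem isPal_wordPoly (m : ℕ) : Matroid.IsPal m (wordPoly 0 m) := by
  induction m using Nat.strong_induction_on with
  | _ m ih =>
    rcases m with _ | _ | m
    · rw [wordPoly_zero_right, fanPoly_zero]
      exact Matroid.isPal_one
    · have : wordPoly 0 1 = 1 + X := by
        rw [wordPoly, wordSeries, flatSeries_eq, mul_assoc (PowerSeries.C _) PowerSeries.X,
          pow_two, mul_assoc (PowerSeries.C _), mul_assoc PowerSeries.X]
        have h0 := wordPoly_zero_right 0
        rw [wordPoly, wordSeries, fanPoly_zero] at h0
        have h1 (f : ℤ[X]⟦X⟧) : PowerSeries.coeff 1 (PowerSeries.X * f) = PowerSeries.coeff 0 f :=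
          PowerSeries.coeff_succ_X_mul 0 f
        simp only [map_add (PowerSeries.coeff 1), PowerSeries.coeff_C_mul, h1, h0]
        simp [PowerSeries.coeff_one]
      rw [zero_add, this]
      exact Matroid.isPal_one_add_X
    · have : wordPoly 0 (m + 2) = (1 + X) * wordPoly 0 (m + 1) +
          X * ∑ ij ∈ Finset.HasAntidiagonal.antidiagonal m, wordPoly 0 ij.1 * wordPoly 0 ij.2 := by
        rw [wordPoly, wordSeries, flatSeries_eq]
        have : (PowerSeries.C X * PowerSeries.X ^ 2 * flatSeries ^ 2 : ℤ[X]⟦X⟧) =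
          PowerSeries.C X * (PowerSeries.X * (PowerSeries.X * (flatSeries * flatSeries))) := by ring
        rw [this, mul_assoc]
        simp only [map_add, PowerSeries.coeff_C_mul, PowerSeries.coeff_succ_X_mul,
          PowerSeries.coeff_mul _ flatSeries]
        simp [PowerSeries.coeff_one, wordPoly, wordSeries, add_mul]
      rw [this]
      refine .add ?_ ?_
      · have := Matroid.isPal_one_add_X.mul (ih (m + 1) (by omega))
        rwa [show 1 + (m + 1) = m + 2 by ring] at this
      · rw [Finset.mul_sum]
        refine Matroid.IsPal.sum fun ij hij => ?_
        rw [Finset.HasAntidiagonal.mem_antidiagonal] at hij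
        have := Matroid.isPal_X.mul ((ih ij.1 (by omega)).mul (ih ij.2 (by omega)))
        rwa [hij, show 2 + m = m + 2 by ring] at this

end FanGraph

namespace FanGraph

/-- The multinomial coefficient is `centralBinom k * choose m (2 * k)`, and `(k + 1) * catalan k =
centralBinom k`. -/
theorem catalan_mul_choose_eq (m k : ℕ) (hk : 2 * k ≤ m) :
    ((catalan k * m.choose (2 * k) : ℕ) : ℚ) =
      1 / ((k : ℚ) + 1) * (Nat.multinomial Finset.univ ![k, k, m - 2 * k] : ℚ) := by
  have h1 := succ_mul_catalan_eq_centralBinom k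
  have h2 : Nat.multinomial Finset.univ ![k, k, m - 2 * k] =
      Nat.centralBinom k * m.choose (2 * k) := by
    have h3 := Nat.multinomial_spec Finset.univ ![k, k, m - 2 * k]
    simp only [Fin.prod_univ_three, Fin.sum_univ_three, Matrix.cons_val] at h3
    rw [show k + k + (m - 2 * k) = m by omega] at h3
    have h4 := Nat.choose_mul_factorial_mul_factorial hk
    have h5 := Nat.choose_mul_factorial_mul_factorial (show k ≤ 2 * k by omega)
    rw [show 2 * k - k = k by omega, ← Nat.centralBinom_eq_two_mul_choose] at h5
    rw [← h4, ← h5] at h3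
    have h6 : 0 < k.factorial * k.factorial * (m - 2 * k).factorial := by positivity
    refine Nat.eq_of_mul_eq_mul_left h6 (h3.trans ?_)
    ring
  rw [h2, ← h1]
  push_cast
  field_simp

theorem map_fanPoly_succ (m : ℕ) :
    (fanPoly (m + 1)).map (Int.castRingHom ℚ) = ∑ k ∈ Finset.range (m / 2 + 1),
      C (1 / ((k : ℚ) + 1) * (Nat.multinomial Finset.univ ![k, k, m - 2 * k] : ℚ)) * X ^ k := by
  have hsub : Finset.range (m / 2 + 1) ⊆ Finset.range (m + 1) :=
    Finset.range_subset_range.2 (by omega)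
  rw [fanPoly_succ, PowerSeries.coeff_motzkinSeries, Polynomial.map_sum,
    ← Finset.sum_subset hsub fun k _ hk => ?_]
  · refine Finset.sum_congr rfl fun k hk => ?_
    rw [← catalan_mul_choose_eq m k (by rw [Finset.mem_range] at hk; omega)]
    simp
  · rw [Nat.choose_eq_zero_of_lt (by rw [Finset.mem_range] at hk; omega)]
    simp

/-! ### Words encoding flats, and sums over coarser words -/

/-- The letters of the words that encode the flats of the fan: the vertices `1, …, n` of the path
are in the block of the vertex `0`, or start a new block, or continue the block of the preceding
vertex. -/
inductive Letter
  | zero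
  | start
  | cont
  deriving DecidableEq

open Letter

/-- Consecutive vertices with letters `a` and `x` are in the same block. -/
def Joined (a x : Letter) : Prop := x = cont ∨ (a = zero ∧ x = zero)

/-- In a word that is preceded by the letter `a`, no `cont` follows a `zero`. -/
def Valid : Letter → List Letter → Prop
  | _, [] => True
  | a, x :: w => (x = cont → a ≠ zero) ∧ Valid x w

/-- The partition encoded by `w`, preceded by the letter `a`, refines the one encoded by `v`,
preceded by the letter `b`. -/
def Refines : Letter → Letter → List Letter → List Letter → Prop
  | _, _, [], [] => True
  | a, b, x :: w, y :: v =>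
      (x = zero → y = zero) ∧ (Joined a x → Joined b y) ∧ Refines x y w v
  | _, _, _, _ => False

/-- The words that are refined by a given word, where the Boolean tells whether a letter `cont` may
come first. -/
def coarsenings : Bool → List Letter → Finset (List Letter)
  | _, [] => {[]}
  | _, zero :: w => (coarsenings false w).image (zero :: ·)
  | true, cont :: w => (coarsenings true w).image (cont :: ·)
  | false, cont :: w => (coarsenings false w).image (zero :: ·)
  | true, start :: w => (coarsenings false w).image (zero :: ·) ∪
      ((coarsenings true w).image (start :: ·) ∪ (coarsenings true w).image (cont :: ·))
  | false, start :: w =>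
      (coarsenings false w).image (zero :: ·) ∪ (coarsenings true w).image (start :: ·)

/-- The number of blocks before the first `zero`. -/
def leadBlocks : List Letter → ℕ
  | [] => 0
  | zero :: _ => 0
  | start :: w => leadBlocks w + 1
  | cont :: w => leadBlocks w

/-- The product of the values of `f` at the numbers of blocks between consecutive `zero`s, from the
first `zero` on. -/
noncomputable def runProd (f : ℕ → ℤ[X]) : List Letter → ℤ[X]
  | [] => 1
  | zero :: w => f (leadBlocks w) * runProd f w
  | start :: w => runProd f w
  | cont :: w => runProd f w

theorem sum_image_cons {R : Type*} [AddCommMonoid R] (a : Letter) (s : Finset (List Letter))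
    (f : List Letter → R) : ∑ v ∈ s.image (a :: ·), f v = ∑ v ∈ s, f (a :: v) :=
  Finset.sum_image fun _ _ _ _ h => List.tail_eq_of_cons_eq h

theorem disjoint_image_cons {a b : Letter} (h : a ≠ b) (s t : Finset (List Letter)) :
    Disjoint (s.image (a :: ·)) (t.image (b :: ·)) := by
  rw [Finset.disjoint_left]
  simp only [Finset.mem_image, not_exists, not_and]
  rintro _ ⟨v, _, rfl⟩ u _ hu
  exact h (List.head_eq_of_cons_eq hu).symm

/-- The rank of the flat encoded by a word. -/
def wordRank (w : List Letter) : ℕ := w.countP (· ≠ start)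

/-- Here `k` counts the blocks of the current run of `v` already read; a `cont` may come next
exactly when `k > 0`. At a `start` of `w` the choices for `v` reproduce the recursion of `wordPoly`,
while a `zero` of `w` forces a `zero` and splits off a factor. -/
theorem sum_coarsenings (k : ℕ) (w : List Letter) :
    ∑ v ∈ coarsenings (decide (0 < k)) w,
        X ^ wordRank v * (fanPoly (k + leadBlocks v) * runProd fanPoly v) =
      X ^ wordRank w * (wordPoly k (leadBlocks w) * runProd (wordPoly 0) w) := by
  have hz (v : List Letter) : wordRank (zero :: v) = wordRank v + 1 := by simp [wordRank]
  have hs (v : List Letter) : wordRank (start :: v) = wordRank v := by simp [wordRank]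
  have hc (v : List Letter) : wordRank (cont :: v) = wordRank v + 1 := by simp [wordRank]
  induction w generalizing k with
  | nil => simp [coarsenings, leadBlocks, runProd, wordPoly_zero_right]
  | cons x w ih =>
    have ih0 := ih 0
    have hZ : ∑ v ∈ (coarsenings false w).image (zero :: ·),
        X ^ wordRank v * (fanPoly (k + leadBlocks v) * runProd fanPoly v) =
        X * fanPoly k * (X ^ wordRank w * (wordPoly 0 (leadBlocks w) * runProd (wordPoly 0) w)) := by
      simp only [lt_irrefl, decide_false, zero_add] at ih0
      rw [sum_image_cons, ← ih0, Finset.mul_sum]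
      refine Finset.sum_congr rfl fun v _ => ?_
      rw [hz, leadBlocks, runProd, add_zero]
      ring
    have hS : ∑ v ∈ (coarsenings true w).image (start :: ·),
        X ^ wordRank v * (fanPoly (k + leadBlocks v) * runProd fanPoly v) =
        X ^ wordRank w * (wordPoly (k + 1) (leadBlocks w) * runProd (wordPoly 0) w) := by
      have ih1 := ih (k + 1)
      simp only [Nat.zero_lt_succ, decide_true] at ih1
      rw [sum_image_cons, ← ih1]
      refine Finset.sum_congr rfl fun v _ => ?_
      rw [hs, leadBlocks, runProd, add_right_comm k 1, add_assoc k]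
    cases x with
    | zero =>
      rw [coarsenings, hZ, hz, leadBlocks, wordPoly_zero_right, runProd]
      ring
    | start =>
      rw [hs, leadBlocks, runProd]
      rcases k with _ | k
      · rw [show decide (0 < 0) = false from rfl, coarsenings,
          Finset.sum_union (disjoint_image_cons (by decide) _ _), hZ, hS, wordPoly_zero_succ,
          fanPoly_zero]
        ring
      · have ih1 := ih (k + 1)
        simp only [Nat.zero_lt_succ, decide_true] at ih1 ⊢
        have hC : ∑ v ∈ (coarsenings true w).image (cont :: ·),
            X ^ wordRank v * (fanPoly (k + 1 + leadBlocks v) * runProd fanPoly v) =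
            X * (X ^ wordRank w *
              (wordPoly (k + 1) (leadBlocks w) * runProd (wordPoly 0) w)) := by
          rw [sum_image_cons, ← ih1, Finset.mul_sum]
          refine Finset.sum_congr rfl fun v _ => ?_
          rw [hc, leadBlocks, runProd]
          ring
        rw [coarsenings, Finset.sum_union (Finset.disjoint_union_right.2
            ⟨disjoint_image_cons (by decide) _ _, disjoint_image_cons (by decide) _ _⟩),
          Finset.sum_union (disjoint_image_cons (by decide) _ _), hZ, hS, hC, wordPoly_succ_succ]
        ring
    | cont =>
      rw [hc, leadBlocks, runProd]
      rcases k with _ | k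
      · rw [show decide (0 < 0) = false from rfl, coarsenings, hZ, fanPoly_zero]
        ring
      · have ih1 := ih (k + 1)
        simp only [Nat.zero_lt_succ, decide_true] at ih1 ⊢
        rw [coarsenings, sum_image_cons, pow_succ', mul_assoc, ← ih1, Finset.mul_sum]
        refine Finset.sum_congr rfl fun v _ => ?_
        rw [hc, leadBlocks, runProd]
        ring

/-- A multiplicative graded property of the values of `f` passes to the products over the runs of
a word. -/
theorem runProd_induction {f : ℕ → ℤ[X]} {p : ℕ → ℤ[X] → Prop} (hf : ∀ n, p n (f n)) (h1 : p 0 1)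
    (hmul : ∀ {d e f g}, p d f → p e g → p (d + e) (f * g)) (w : List Letter) :
    p (w.count start) (f (leadBlocks w) * runProd f w) := by
  suffices h : ∃ d, w.count start = leadBlocks w + d ∧ p d (runProd f w) by
    obtain ⟨d, hd, hp⟩ := h
    rw [hd]
    exact hmul (hf _) hp
  induction w with
  | nil => exact ⟨0, rfl, h1⟩
  | cons x w ih =>
    obtain ⟨d, hd, hp⟩ := ih
    cases x with
    | zero => exact ⟨leadBlocks w + d, by simp [leadBlocks, hd], hmul (hf _) hp⟩
    | start => exact ⟨d, by simp [leadBlocks, hd, add_right_comm], hp⟩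
    | cont => exact ⟨d, by simp [leadBlocks, hd], hp⟩

/-- The candidate for the Kazhdan–Lusztig polynomial of the contraction of the flat encoded by a
word. -/
noncomputable def wordKL (w : List Letter) : ℤ[X] := fanPoly (leadBlocks w) * runProd fanPoly w

theorem wordKL_degree (w : List Letter) : (w.count start = 0 ∧ wordKL w = 1) ∨
    2 * (wordKL w).natDegree < w.count start := by
  refine runProd_induction (p := fun d f => (d = 0 ∧ f = 1) ∨ 2 * f.natDegree < d) ?_ ?_ ?_ w
  · rintro (_ | n)
    · exact Or.inl ⟨rfl, fanPoly_zero⟩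
    · exact Or.inr (two_mul_natDegree_fanPoly_lt n)
  · exact Or.inl ⟨rfl, rfl⟩
  · rintro d e f g (⟨rfl, rfl⟩ | hf) (⟨rfl, rfl⟩ | hg)
    · simp
    · simpa using Or.inr hg
    · simpa using Or.inr hf
    · have := natDegree_mul_le (p := f) (q := g)
      omega

theorem exists_isPal_sum_coarsenings (w : List Letter) :
    ∃ Q, Matroid.IsPal (w.count start) Q ∧
      ∑ v ∈ coarsenings false w, X ^ wordRank v * wordKL v = X ^ wordRank w * Q := by
  refine ⟨_, runProd_induction isPal_wordPoly Matroid.isPal_one Matroid.IsPal.mul w, ?_⟩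
  simpa [wordKL] using sum_coarsenings 0 w

theorem count_start_add_wordRank (w : List Letter) : w.count start + wordRank w = w.length := by
  rw [List.length_eq_countP_add_countP (· == start), List.count, wordRank]
  congr 2
  ext x
  simp

/-- Only the preceding letter `b` of the coarser word matters: a valid `cont` is always joined to
its predecessor, and for two consecutive `zero`s of `w` the joining condition on `v` is automatic by
`hab`. -/
theorem mem_coarsenings {a b : Letter} {w v : List Letter} (hab : a = zero → b = zero)
    (hw : Valid a w) :
    v ∈ coarsenings (decide (b ≠ zero)) w ↔ Valid b v ∧ Refines a b w v := by
  induction w generalizing a b v with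
  | nil => cases v <;> simp [coarsenings, Refines, Valid]
  | cons x w ih =>
    obtain ⟨hx, hw⟩ := hw
    rcases v with _ | ⟨y, v⟩
    · cases x <;> cases b <;> simp [coarsenings, Refines]
    have key (hxy : x = zero → y = zero) := ih (v := v) hxy hw
    cases x <;> cases y <;> cases b <;> cases a <;>
      simp_all [coarsenings, Refines, Valid, Joined]

theorem Refines.antisymm {a b : Letter} {w v : List Letter} (h : Refines a b w v)
    (h' : Refines b a v w) : w = v := by
  induction w generalizing a b v with
  | nil => cases v with
    | nil => rfl
    | cons => exact h.elim
  | cons x w ih => cases v with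
    | nil => exact h.elim
    | cons y v =>
      obtain ⟨h1, h2, h3⟩ := h
      obtain ⟨h1', h2', h3'⟩ := h'
      rw [ih h3 h3']
      congr 1
      cases x <;> cases y <;> simp_all [Joined]

theorem valid_iff_getD {a : Letter} {w : List Letter} :
    Valid a w ↔ ∀ i < w.length, w.getD i zero = cont → (a :: w).getD i zero ≠ zero := by
  induction w generalizing a with
  | nil => simp [Valid]
  | cons x w ih =>
    rw [Valid, ih, List.length_cons, Nat.forall_lt_succ_left]
    simp only [List.getD_cons_zero, List.getD_cons_succ]

theorem refines_iff_getD {a b : Letter} {w v : List Letter} :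
    Refines a b w v ↔ w.length = v.length ∧ ∀ i < w.length,
      (w.getD i zero = zero → v.getD i zero = zero) ∧
      (Joined ((a :: w).getD i zero) (w.getD i zero) →
        Joined ((b :: v).getD i zero) (v.getD i zero)) := by
  induction w generalizing a b v with
  | nil => cases v <;> simp [Refines]
  | cons x w ih => cases v with
    | nil => simp [Refines]
    | cons y v =>
      rw [Refines, ih, List.length_cons, List.length_cons, Nat.forall_lt_succ_left]
      simp only [List.getD_cons_zero, List.getD_cons_succ, add_left_inj]
      tauto

theorem card_filter_getD (w : List Letter) :
    (Finset.univ.filter fun i : Fin w.length => w.getD i zero ≠ start).card = wordRank w := by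
  rw [Finset.card_filter,
    Fin.sum_univ_eq_sum_range (fun i => if w.getD i zero ≠ start then 1 else 0)]
  induction w with
  | nil => rfl
  | cons x w ih =>
    rw [List.length_cons, Finset.sum_range_succ']
    simp only [List.getD_cons_succ, List.getD_cons_zero, ih]
    simp [wordRank, List.countP_cons]

end FanGraph
open scoped Matroid

/-! ### Closure and flats in cycle matroids -/

namespace SimpleGraph

/-- A graph on a linear order in which every vertex has at most one smaller neighbour is a
forest. -/
theorem isAcyclic_of_unique_lt {V : Type*} [LinearOrder V] {H : SimpleGraph V}
    (h : ∀ v a b, a < v → b < v → H.Adj v a → H.Adj v b → a = b) : H.IsAcyclic := by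
  intro u c hc
  obtain ⟨m, hm, hmax⟩ := c.support.toFinset.exists_max_image id
    ⟨u, List.mem_toFinset.2 c.start_mem_support⟩
  rw [List.mem_toFinset] at hm
  have hc' := hc.rotate hm
  have hlt : ∀ x ∈ (c.rotate m hm).support, H.Adj m x → x < m := by
    intro x hx hadj
    refine lt_of_le_of_ne (hmax x (List.mem_toFinset.2 ?_)) hadj.ne'
    rwa [Walk.mem_support_rotate_iff] at hx
  have h1 := Walk.adj_snd hc'.not_nil
  have h2 := (Walk.adj_penultimate hc'.not_nil).symm
  exact hc'.snd_ne_penultimate (h _ _ _ (hlt _ (Walk.getVert_mem_support _ _) h1)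
    (hlt _ (Walk.getVert_mem_support _ _) h2) h1 h2)

section Closure

variable {V : Type*} [Finite V] {G : SimpleGraph V} {u v : V}

/-- An edge between different components of a forest creates no cycle, while every edge of a forest
is a bridge, so no new edge can join two connected vertices. -/
theorem mem_closure_iff_reachable_of_indep {I : Set (Sym2 V)} (hI : G.cycleMatroid.Indep I)
    (huv : G.Adj u v) :
    s(u, v) ∈ G.cycleMatroid.closure I ↔ (fromEdgeSet I).Reachable u v := by
  obtain ⟨hIG, hIa⟩ := (cycleMatroid_indep G I).1 hI
  rw [hI.mem_closure_iff', cycleMatroid_ground, cycleMatroid_indep]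
  constructor
  · rintro ⟨-, h⟩
    by_contra hnr
    have h1 := hIa.sup_edge_of_not_reachable hnr
    rw [edge, ← fromEdgeSet_union, Set.union_singleton] at h1
    have h2 := h ⟨Set.insert_subset huv hIG, h1⟩
    exact hnr ((fromEdgeSet_adj I).2 ⟨h2, huv.ne⟩).reachable
  · refine fun hr => ⟨huv, fun h => ?_⟩
    by_contra hnot
    have hadj : (fromEdgeSet (insert s(u, v) I)).Adj u v :=
      (fromEdgeSet_adj _).2 ⟨Set.mem_insert _ _, huv.ne⟩
    have hb := isBridge_iff.1 (isAcyclic_iff_forall_adj_isBridge.1 h.2 hadj)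
    refine hb (hr.mono fun a b hab => ?_)
    obtain ⟨habI, hne⟩ := (fromEdgeSet_adj I).1 hab
    rw [deleteEdges_adj]
    exact ⟨(fromEdgeSet_adj _).2 ⟨Set.mem_insert_of_mem _ habI, hne⟩,
      fun heq => hnot (Set.mem_singleton_iff.1 heq ▸ habI)⟩

/-- An edge is in the closure of a set `F` of edges if and only if its ends are connected by `F`. -/
theorem mem_closure_iff_reachable {F : Set (Sym2 V)} (hF : F ⊆ G.edgeSet) (huv : G.Adj u v) :
    s(u, v) ∈ G.cycleMatroid.closure F ↔ (fromEdgeSet F).Reachable u v := by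
  obtain ⟨I, hI⟩ := G.cycleMatroid.exists_isBasis F hF
  rw [← hI.closure_eq_closure, mem_closure_iff_reachable_of_indep hI.indep huv]
  refine ⟨fun h => h.mono (fromEdgeSet_mono hI.subset), ?_⟩
  rintro ⟨p⟩
  clear huv
  induction p with
  | nil => exact Reachable.refl _
  | cons h _ ih =>
    have hab := ((fromEdgeSet_adj F).1 h).1
    exact ((mem_closure_iff_reachable_of_indep hI.indep (hF hab)).1
      (hI.subset_closure hab)).trans ih

theorem isFlat_cycleMatroid_iff {F : Set (Sym2 V)} (hF : F ⊆ G.edgeSet) :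
    G.cycleMatroid.IsFlat F ↔
      ∀ u v, G.Adj u v → (fromEdgeSet F).Reachable u v → s(u, v) ∈ F := by
  rw [Matroid.isFlat_iff_closure_eq]
  constructor
  · intro h u v huv hr
    rwa [← h, mem_closure_iff_reachable hF huv]
  · refine fun h => Set.Subset.antisymm (fun e he => ?_) (G.cycleMatroid.subset_closure F hF)
    have heG : e ∈ G.edgeSet := G.cycleMatroid.closure_subset_ground F he
    induction e with
    | _ u v => exact h u v heG ((mem_closure_iff_reachable hF heG).1 he)

end Closure

theorem fan_adj_of_lt {n : ℕ} {a b : Fin (n + 1)} (h : a < b) :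
    (fan n).Adj a b ↔ a = 0 ∨ b.val = a.val + 1 := by
  rw [fan, fromRel_adj]
  have h' : a.val < b.val := h
  have h0 : a = 0 ↔ a.val = 0 := Fin.ext_iff
  rw [h0]
  have : a ≠ b := h.ne
  simp only [this, ne_eq, not_false_eq_true, true_and]
  omega

end SimpleGraph

/-! ### Flats of the fan as words -/

namespace FanGraph

open Letter SimpleGraph

/-- The block of the vertex `i` in the partition encoded by `w`. -/
def block (w : List Letter) (i : ℕ) : ℕ :=
  -- Prepending `zero` gives vertex `0` its letter, so index `i` is vertex `i`; in `w` itself index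
  -- `i` is vertex `i + 1`. The `+ 1` keeps the number nonzero even for words that are not valid.
  if (zero :: w).getD i zero = zero then 0 else (w.take i).count start + 1

theorem block_zero (w : List Letter) : block w 0 = 0 := by simp [block]

theorem block_eq_zero_iff (w : List Letter) (i : ℕ) :
    block w i = 0 ↔ (zero :: w).getD i zero = zero := by
  rw [block]
  split_ifs with h
  · exact iff_of_true rfl h
  · exact iff_of_false (by simp) h

theorem block_eq_succ_iff {w : List Letter} (hw : Valid zero w) {i : ℕ} (hi : i < w.length) :
    block w i = block w (i + 1) ↔ Joined ((zero :: w).getD i zero) (w.getD i zero) := by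
  have hv := valid_iff_getD.1 hw i hi
  have hc : (w.take (i + 1)).count start =
      (w.take i).count start + if w.getD i zero = start then 1 else 0 := by
    rw [List.take_add_one, List.count_append, List.getD_eq_getElem?_getD, List.getElem?_eq_getElem hi]
    simp [List.count_singleton]
  rw [block, block, List.getD_cons_succ, hc]
  generalize (zero :: w).getD i zero = a at *
  generalize w.getD i zero = x at *
  generalize (w.take i).count start = c
  cases a <;> cases x <;> simp_all [Joined]

/-- The subgraph of the fan whose edges are those inside the blocks of a word. -/
def blockGraph (n : ℕ) (w : List Letter) : SimpleGraph (Fin (n + 1)) where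
  Adj a b := (fan n).Adj a b ∧ block w a = block w b
  symm := ⟨fun _ _ h => ⟨h.1.symm, h.2.symm⟩⟩
  loopless := ⟨fun _ h => h.1.ne rfl⟩

theorem blockGraph_le (n : ℕ) (w : List Letter) : blockGraph n w ≤ fan n := fun _ _ h => h.1

/-- The edges inside the fibres of any function on the vertices form a flat, because the function is
constant on components. -/
theorem isFlat_blockGraph (n : ℕ) (w : List Letter) :
    (fan n).cycleMatroid.IsFlat (blockGraph n w).edgeSet := by
  rw [isFlat_cycleMatroid_iff (edgeSet_mono (blockGraph_le n w)), fromEdgeSet_edgeSet]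
  rintro u v huv ⟨p⟩
  refine ⟨huv, ?_⟩
  clear huv
  induction p with
  | nil => rfl
  | cons h _ ih => exact h.2.trans ih

theorem fan_adj_zero {n : ℕ} (i : Fin n) : (fan n).Adj 0 i.succ :=
  (fan_adj_of_lt i.succ_pos).2 (Or.inl rfl)

theorem fan_adj_succ {n : ℕ} (i : Fin n) : (fan n).Adj i.castSucc i.succ :=
  (fan_adj_of_lt i.castSucc_lt_succ).2 (Or.inr (by simp))

/-- Subgraphs of the fan can be compared on the spokes and on the pairs `(i, i + 1)`. -/
theorem le_iff_of_le_fan {n : ℕ} {H K : SimpleGraph (Fin (n + 1))} (hH : H ≤ fan n) :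
    H ≤ K ↔ ∀ i : Fin n, (H.Adj 0 i.succ → K.Adj 0 i.succ) ∧
      (H.Adj i.castSucc i.succ → K.Adj i.castSucc i.succ) := by
  refine ⟨fun h i => ⟨fun h' => h h', fun h' => h h'⟩, fun h => ?_⟩
  have key : ∀ a b, a < b → H.Adj a b → K.Adj a b := by
    intro a b hab hadj
    obtain ⟨i, rfl⟩ := Fin.exists_succ_eq.2 (Fin.ne_zero_of_lt hab)
    rcases (fan_adj_of_lt hab).1 (hH hadj) with rfl | h'
    · exact (h i).1 hadj
    · obtain rfl : a = i.castSucc := Fin.ext (by simpa using h'.symm)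
      exact (h i).2 hadj
  intro a b hadj
  rcases lt_or_gt_of_ne hadj.ne with hab | hab
  · exact key a b hab hadj
  · exact (key b a hab hadj.symm).symm

section Words

variable {n : ℕ} {w v : List Letter}

theorem blockGraph_adj_zero (w : List Letter) (i : Fin n) :
    (blockGraph n w).Adj 0 i.succ ↔ w.getD i zero = zero := by
  have h := block_eq_zero_iff w (i + 1)
  rw [List.getD_cons_succ] at h
  rw [← h]
  simp [blockGraph, fan_adj_zero, block_zero, eq_comm]

theorem blockGraph_adj_succ (hn : w.length = n) (hw : Valid zero w) (i : Fin n) :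
    (blockGraph n w).Adj i.castSucc i.succ ↔
      Joined ((zero :: w).getD i zero) (w.getD i zero) := by
  rw [← block_eq_succ_iff hw (hn ▸ i.2)]
  simp [blockGraph, fan_adj_succ]

theorem blockGraph_le_iff (hn : w.length = n) (hw : Valid zero w) (hn' : v.length = n)
    (hv : Valid zero v) :
    (blockGraph n w).edgeSet ⊆ (blockGraph n v).edgeSet ↔ Refines zero zero w v := by
  rw [edgeSet_subset_edgeSet, le_iff_of_le_fan (blockGraph_le n w), refines_iff_getD,
    and_iff_right (hn.trans hn'.symm)]
  simp only [blockGraph_adj_zero w, blockGraph_adj_zero v, blockGraph_adj_succ hn hw,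
    blockGraph_adj_succ hn' hv]
  subst hn
  exact ⟨fun h i hi => h ⟨i, hi⟩, fun h i => h i i.2⟩

theorem blockGraph_injective (hn : w.length = n) (hw : Valid zero w) (hn' : v.length = n)
    (hv : Valid zero v) (h : (blockGraph n w).edgeSet = (blockGraph n v).edgeSet) : w = v :=
  ((blockGraph_le_iff hn hw hn' hv).1 h.subset).antisymm
    ((blockGraph_le_iff hn' hv hn hw).1 h.superset)

/-- The letters record reachability in `F`, which for neighbours in the fan is the same as adjacency
since `F` is a flat. Connection to `0` is tested first, so a `cont` never follows a `zero`. -/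
theorem exists_word_of_isFlat {F : Set (Sym2 (Fin (n + 1)))} (hF : (fan n).cycleMatroid.IsFlat F) :
    ∃ w : List Letter, w.length = n ∧ Valid zero w ∧ (blockGraph n w).edgeSet = F := by
  classical
  have hFE : F ⊆ (fan n).edgeSet := hF.subset_ground
  have hle : fromEdgeSet F ≤ fan n := fun a b h => hFE h.1
  have hr : ∀ {a b}, (fan n).Adj a b →
      ((fromEdgeSet F).Adj a b ↔ (fromEdgeSet F).Reachable a b) := fun hab =>
    ⟨fun h => h.reachable, fun h =>
      (fromEdgeSet_adj F).2 ⟨(isFlat_cycleMatroid_iff hFE).1 hF _ _ hab h, hab.ne⟩⟩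
  let l : Fin n → Letter := fun i =>
    if (fromEdgeSet F).Reachable 0 i.succ then zero
    else if (fromEdgeSet F).Reachable i.castSucc i.succ then cont else start
  have hlen : (List.ofFn l).length = n := List.length_ofFn
  have hl (i : Fin n) : (List.ofFn l).getD i zero = l i := by simp
  have hlz (i : Fin n) : l i = zero ↔ (fromEdgeSet F).Reachable 0 i.succ := by
    simp only [l]
    split_ifs <;> simp [*]
  have hlc (i : Fin n) : l i = cont ↔ ¬ (fromEdgeSet F).Reachable 0 i.succ ∧
      (fromEdgeSet F).Reachable i.castSucc i.succ := by
    simp only [l]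
    split_ifs <;> simp [*]
  have hpz (i : Fin n) : (zero :: List.ofFn l).getD i zero = zero ↔
      (fromEdgeSet F).Reachable 0 i.castSucc := by
    obtain ⟨i, hi⟩ := i
    rcases i with _ | i
    · simp
    · have := hl ⟨i, by omega⟩
      rw [List.getD_cons_succ, this, hlz]
      rfl
  have hvalid : Valid zero (List.ofFn l) := by
    rw [valid_iff_getD]
    intro i hi hc hz
    lift i to Fin n using hlen ▸ hi
    rw [hl, hlc] at hc
    exact hc.1 (((hpz i).1 hz).trans hc.2)
  refine ⟨List.ofFn l, hlen, hvalid, ?_⟩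
  have hFG : (fromEdgeSet F).edgeSet = F := by
    rw [edgeSet_fromEdgeSet, sdiff_eq_left, Set.disjoint_left]
    exact fun e he => (fan n).not_isDiag_of_mem_edgeSet (hFE he)
  have hadj0 (i : Fin n) : (blockGraph n (List.ofFn l)).Adj 0 i.succ ↔
      (fromEdgeSet F).Adj 0 i.succ := by
    rw [blockGraph_adj_zero _, hl, hlz, hr (fan_adj_zero i)]
  have hadj1 (i : Fin n) : (blockGraph n (List.ofFn l)).Adj i.castSucc i.succ ↔
      (fromEdgeSet F).Adj i.castSucc i.succ := by
    rw [blockGraph_adj_succ hlen hvalid, hr (fan_adj_succ i), Joined, hpz, hl, hlz, hlc]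
    constructor
    · rintro (h | ⟨h, h'⟩)
      exacts [h.2, h.symm.trans h']
    · intro h
      by_cases h0 : (fromEdgeSet F).Reachable 0 i.succ
      exacts [Or.inr ⟨h0.trans h.symm, h0⟩, Or.inl ⟨h0, h⟩]
  rw [← hFG]
  congr 1
  refine le_antisymm ((le_iff_of_le_fan (blockGraph_le _ _)).2 fun i => ?_)
    ((le_iff_of_le_fan hle).2 fun i => ?_)
  · exact ⟨(hadj0 i).1, (hadj1 i).1⟩
  · exact ⟨(hadj0 i).2, (hadj1 i).2⟩

/-- The vertex before `i + 1` in the tree that spans its block and is rooted at the first vertex of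
the block. -/
def parent (n : ℕ) (w : List Letter) (i : Fin n) : Fin (n + 1) :=
  if w.getD i zero = zero then 0 else i.castSucc

theorem parent_lt (w : List Letter) (i : Fin n) : parent n w i < i.succ := by
  rw [parent]
  split_ifs
  exacts [i.succ_pos, i.castSucc_lt_succ]

theorem parent_edge_injective (w : List Letter) :
    Function.Injective fun i => s(parent n w i, i.succ) := by
  intro i j h
  rcases Sym2.eq_iff.1 h with ⟨-, h⟩ | ⟨h1, h2⟩
  · exact Fin.succ_injective n h
  · have hi := parent_lt w i
    have hj := parent_lt w j
    rw [h1] at hi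
    rw [← h2] at hj
    exact (lt_asymm hi hj).elim

/-- The edges that join the vertices to their parents. -/
def spanningForest (n : ℕ) (w : List Letter) : Set (Sym2 (Fin (n + 1))) :=
  (fun i => s(parent n w i, i.succ)) '' {i | w.getD i zero ≠ start}

/-- The only smaller neighbour of a vertex is its parent, so there is no cycle. The remaining block
edges join consecutive vertices of the block of `0` and close a triangle with two spokes. -/
theorem isBasis_spanningForest (hn : w.length = n) (hw : Valid zero w) :
    (fan n).cycleMatroid.IsBasis (spanningForest n w) (blockGraph n w).edgeSet := by
  have hsub : spanningForest n w ⊆ (blockGraph n w).edgeSet := by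
    rintro _ ⟨i, hi, rfl⟩
    rw [Set.mem_ofPred_eq] at hi
    simp only [mem_edgeSet, parent]
    split_ifs with h
    · exact (blockGraph_adj_zero w i).2 h
    · refine (blockGraph_adj_succ hn hw i).2 (Or.inl ?_)
      generalize w.getD i zero = x at *
      cases x <;> simp_all
  have hE : spanningForest n w ⊆ (fan n).edgeSet := hsub.trans (edgeSet_mono (blockGraph_le n w))
  have hlow : ∀ a v, a < v → s(v, a) ∈ spanningForest n w →
      ∃ i : Fin n, v = i.succ ∧ a = parent n w i := by
    rintro a v hav ⟨i, -, hi⟩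
    rcases Sym2.eq_iff.1 hi with ⟨h1, h2⟩ | ⟨h1, h2⟩
    · have := parent_lt w i
      rw [h1, h2] at this
      exact (lt_asymm this hav).elim
    · exact ⟨i, h2.symm, h1.symm⟩
  have hind : (fan n).cycleMatroid.Indep (spanningForest n w) := by
    refine (cycleMatroid_indep _ _).2 ⟨hE, isAcyclic_of_unique_lt fun v a b ha hb hva hvb => ?_⟩
    obtain ⟨i, rfl, rfl⟩ := hlow a v ha hva.1
    obtain ⟨j, hj, rfl⟩ := hlow b _ hb hvb.1
    rw [Fin.succ_injective n hj]
  refine hind.isBasis_of_subset_of_subset_closure hsub ?_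
  have hmem (i : Fin n) (hi : w.getD i zero ≠ start) :
      s(parent n w i, i.succ) ∈ (fan n).cycleMatroid.closure (spanningForest n w) :=
    (fan n).cycleMatroid.subset_closure _ hE ⟨i, hi, rfl⟩
  have hzero (i : Fin n) (hi : w.getD i zero = zero) :
      s(0, i.succ) ∈ (fan n).cycleMatroid.closure (spanningForest n w) := by
    have := hmem i (by rw [hi]; decide)
    rwa [parent, if_pos hi] at this
  have hflat := (isFlat_cycleMatroid_iff ((fan n).cycleMatroid.closure_subset_ground _)).1
    ((fan n).cycleMatroid.isFlat_closure (spanningForest n w))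
  have hreach : ∀ {a b}, s(a, b) ∈ (fan n).cycleMatroid.closure (spanningForest n w) →
      (fromEdgeSet ((fan n).cycleMatroid.closure (spanningForest n w))).Reachable a b := by
    intro a b h
    have hab : (fan n).Adj a b := (fan n).cycleMatroid.closure_subset_ground _ h
    exact ((fromEdgeSet_adj _).2 ⟨h, hab.ne⟩).reachable
  have hle : blockGraph n w ≤
      fromEdgeSet ((fan n).cycleMatroid.closure (spanningForest n w)) := by
    refine (le_iff_of_le_fan (blockGraph_le n w)).2 fun i => ⟨fun h => ?_, fun h => ?_⟩
    · exact (fromEdgeSet_adj _).2 ⟨hzero i ((blockGraph_adj_zero w i).1 h), h.ne⟩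
    · refine (fromEdgeSet_adj _).2 ⟨?_, h.ne⟩
      rcases (blockGraph_adj_succ hn hw i).1 h with hc | ⟨hp, hz⟩
      · have := hmem i (by rw [hc]; decide)
        rwa [parent, if_neg (by rw [hc]; decide)] at this
      · refine hflat _ _ (fan_adj_succ i) (Reachable.trans (Reachable.symm ?_)
          (hreach (hzero i hz)))
        obtain ⟨i, hi⟩ := i
        -- For `i = 0` the path edge is itself the spoke from `0` to `1`.
        rcases i with _ | i
        · exact Reachable.refl _
        · exact hreach (hzero ⟨i, by omega⟩ hp)
  intro e he
  induction e with
  | _ a b => exact (hle he).1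

theorem rkNat_blockGraph (hn : w.length = n) (hw : Valid zero w) :
    (fan n).cycleMatroid.rkNat (blockGraph n w).edgeSet = wordRank w := by
  rw [Matroid.rkNat, ← (isBasis_spanningForest hn hw).encard_eq_eRk, spanningForest,
    (parent_edge_injective w).encard_image]
  subst hn
  rw [← card_filter_getD w, ← ENat.toNat_natCast (Finset.card _), ← Set.encard_coe_eq_coe_finsetCard,
    Finset.coe_filter_univ]

theorem blockGraph_replicate_zero (n : ℕ) : blockGraph n (List.replicate n zero) = fan n := by
  refine le_antisymm (blockGraph_le _ _) fun a b hab => ⟨hab, ?_⟩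
  have h (i : ℕ) : block (List.replicate n zero) i = 0 := by
    rw [block_eq_zero_iff, ← List.replicate_succ]
    simp only [List.getD_eq_getElem?_getD, List.getElem?_replicate]
    split_ifs <;> rfl
  rw [h, h]

theorem valid_replicate_zero (n : ℕ) (a : Letter) : Valid a (List.replicate n zero) := by
  induction n generalizing a with
  | zero => trivial
  | succ n ih => exact ⟨by simp, ih _⟩

theorem valid_replicate_start (n : ℕ) (a : Letter) : Valid a (List.replicate n start) := by
  induction n generalizing a with
  | zero => trivial
  | succ n ih => exact ⟨by simp, ih _⟩

theorem blockGraph_replicate_start (n : ℕ) : blockGraph n (List.replicate n start) = ⊥ := by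
  refine le_bot_iff.1 ((le_iff_of_le_fan (blockGraph_le _ _)).2 fun i => ?_)
  have h : (List.replicate n start).getD i zero = start := by
    simp
  rw [blockGraph_adj_zero, blockGraph_adj_succ List.length_replicate (valid_replicate_start n _),
    h, Joined]
  simp

/-- The all-`zero` word encodes the whole fan, so the fan has rank `n`; the flat of `w` takes away
every letter other than `start`. -/
theorem rankNat_contract_blockGraph (hn : w.length = n) (hw : Valid zero w) :
    ((fan n).cycleMatroid ／ (blockGraph n w).edgeSet).rankNat = w.count start := by
  have h1 := Matroid.rankNat_contract_add (fan n).cycleMatroid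
    (edgeSet_mono (blockGraph_le n w))
  have h2 := rkNat_blockGraph (n := n) List.length_replicate (valid_replicate_zero n zero)
  have h3 : (fan n).cycleMatroid.rkNat (fan n).edgeSet = (fan n).cycleMatroid.rankNat := by
    rw [Matroid.rkNat, Matroid.rankNat, ← Matroid.eRk_ground, cycleMatroid_ground]
  have h4 := count_start_add_wordRank w
  rw [blockGraph_replicate_zero, h3, wordRank, List.countP_replicate] at h2
  rw [rkNat_blockGraph hn hw, h2] at h1
  simp at h1
  omega

theorem mem_coarsenings_iff (hn : w.length = n) (hw : Valid zero w) :
    v ∈ coarsenings false w ↔ v.length = n ∧ Valid zero v ∧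
      (blockGraph n w).edgeSet ⊆ (blockGraph n v).edgeSet := by
  have h := mem_coarsenings (v := v) (a := zero) (b := zero) id hw
  rw [show decide (zero ≠ zero) = false from rfl] at h
  rw [h]
  constructor
  · rintro ⟨h1, h2⟩
    have h3 : v.length = n := hn ▸ (refines_iff_getD.1 h2).1.symm
    exact ⟨h3, h1, (blockGraph_le_iff hn hw h3 h1).2 h2⟩
  · rintro ⟨h1, h2, h3⟩
    exact ⟨h2, (blockGraph_le_iff hn hw h1 h2).1 h3⟩

end Words

/-! ### The Kazhdan–Lusztig polynomials of the fans -/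

open Classical in
/-- The candidate for the Kazhdan–Lusztig polynomial of the contraction of a flat. -/
noncomputable def flatKL (n : ℕ) (F : Set (Sym2 (Fin (n + 1)))) : ℤ[X] :=
  if h : ∃ w : List Letter, w.length = n ∧ Valid zero w ∧ (blockGraph n w).edgeSet = F then
    wordKL h.choose
  else 0

theorem flatKL_blockGraph {n : ℕ} {w : List Letter} (hn : w.length = n) (hw : Valid zero w) :
    flatKL n (blockGraph n w).edgeSet = wordKL w := by
  have h : ∃ v : List Letter, v.length = n ∧ Valid zero v ∧
      (blockGraph n v).edgeSet = (blockGraph n w).edgeSet := ⟨w, hn, hw, rfl⟩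
  rw [flatKL, dif_pos h]
  congr 1
  exact blockGraph_injective h.choose_spec.1 h.choose_spec.2.1 hn hw h.choose_spec.2.2

open Classical in
theorem sum_flats_ge {n : ℕ} {w : List Letter} (hn : w.length = n) (hw : Valid zero w)
    (f : Set (Sym2 (Fin (n + 1))) → ℤ[X]) :
    ∑ G ∈ (fan n).cycleMatroid.flatsFinset with (blockGraph n w).edgeSet ⊆ G, f G =
      ∑ v ∈ coarsenings false w, f (blockGraph n v).edgeSet := by
  symm
  refine Finset.sum_bij (fun v _ => (blockGraph n v).edgeSet) ?_ ?_ ?_ ?_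
  · intro v hv
    rw [Finset.mem_filter, Matroid.mem_flatsFinset]
    exact ⟨isFlat_blockGraph n v, ((mem_coarsenings_iff hn hw).1 hv).2.2⟩
  · intro v hv v' hv' h
    rw [mem_coarsenings_iff hn hw] at hv hv'
    exact blockGraph_injective hv.1 hv.2.1 hv'.1 hv'.2.1 h
  · intro G hG
    rw [Finset.mem_filter, Matroid.mem_flatsFinset] at hG
    obtain ⟨v, h1, h2, rfl⟩ := exists_word_of_isFlat hG.1
    exact ⟨v, (mem_coarsenings_iff hn hw).2 ⟨h1, h2, hG.2⟩, rfl⟩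
  · exact fun _ _ => rfl

theorem klPoly_fan (n : ℕ) : Matroid.klPoly (fan n).cycleMatroid = fanPoly n := by
  have key (F) (hF : (fan n).cycleMatroid.IsFlat F) :
      Matroid.klPoly ((fan n).cycleMatroid ／ F) = flatKL n F := by
    refine Matroid.klPoly_contract_eq_of_isPal (flatKL n) ?_ ?_ ?_ hF
    · intro F hF h
      obtain ⟨w, hn, hw, rfl⟩ := exists_word_of_isFlat hF
      rw [rankNat_contract_blockGraph hn hw] at h
      rw [flatKL_blockGraph hn hw]
      have := wordKL_degree w
      exact this.elim And.right fun h' => by omega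
    · intro F hF h
      obtain ⟨w, hn, hw, rfl⟩ := exists_word_of_isFlat hF
      rw [rankNat_contract_blockGraph hn hw] at h ⊢
      rw [flatKL_blockGraph hn hw]
      exact (wordKL_degree w).resolve_left fun h' => h.ne' h'.1
    · intro F hF
      obtain ⟨w, hn, hw, rfl⟩ := exists_word_of_isFlat hF
      obtain ⟨Q, hQ, hs⟩ := exists_isPal_sum_coarsenings w
      refine ⟨Q, (rankNat_contract_blockGraph hn hw).symm ▸ hQ, ?_⟩
      rw [sum_flats_ge hn hw, rkNat_blockGraph hn hw, ← hs]
      refine Finset.sum_congr rfl fun v hv => ?_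
      obtain ⟨h1, h2, -⟩ := (mem_coarsenings_iff hn hw).1 hv
      rw [rkNat_blockGraph h1 h2, flatKL_blockGraph h1 h2]
  -- The all-`start` word encodes the empty flat, whose contraction is the matroid itself; it has a
  -- single run, of `n` blocks.
  have h := key _ (isFlat_blockGraph n (List.replicate n start))
  rw [flatKL_blockGraph List.length_replicate (valid_replicate_start n _), wordKL] at h
  have hlead (m : ℕ) : leadBlocks (List.replicate m start) = m ∧
      runProd fanPoly (List.replicate m start) = 1 := by
    induction m with
    | zero => exact ⟨rfl, rfl⟩
    | succ m ih => exact ⟨congrArg (· + 1) ih.1, ih.2⟩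
  rw [(hlead n).1, (hlead n).2, mul_one] at h
  have h0 : (fan n).cycleMatroid ／ (blockGraph n (List.replicate n start)).edgeSet =
      (fan n).cycleMatroid := by
    rw [blockGraph_replicate_start, edgeSet_bot, Matroid.contract_empty]
  rw [← h]
  congr 1
  exact h0.symm

end FanGraph

theorem theorem3 (n : ℕ) (hn : 1 ≤ n) :
    (Matroid.klPoly (SimpleGraph.fan n).cycleMatroid).map (Int.castRingHom ℚ) =
      ∑ k ∈ Finset.range ((n - 1) / 2 + 1),
        C ((1 / ((k : ℚ) + 1)) *
          (Nat.multinomial Finset.univ ![k, k, n - 2 * k - 1] : ℚ)) * X ^ k := by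
  obtain ⟨m, rfl⟩ := Nat.exists_eq_add_of_le' hn
  rw [FanGraph.klPoly_fan, FanGraph.map_fanPoly_succ, Nat.add_sub_cancel]
  refine Finset.sum_congr rfl fun k _ => ?_
  rw [show m + 1 - 2 * k - 1 = m - 2 * k by omega]
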